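/- Let $A$ be an $m\times n$ random matrix with i.i.d. $N(0,1)$ entries. For $p\in(0,1]$, a set $T\subseteq\{1,\dots,m\}$ and a sign pattern $s\in\{\pm1\}^T$, say that $A$ *recovers by $\ell_p$ on $(T,s)$* if for every $f\in\mathbb{R}^n$ and every $e\in\mathbb{R}^m$ with support $\{i:e_i\neq0\}=T$ and $\operatorname{sign}(e_i)=s_i$ for all $i\in T$, the vector $f$ is the unique solution of $$\min_{x\in\mathbb{R}^n}\|y-Ax\|_p^p,\qquad y=Af+e,\qquad \|v\|_p^p:=\sum_i|v_i|^p .$$ 1. (Recovery below $2/3$ for $p<1$.) For every $p\in(0,1)$ and every $\rho<\tfrac23$ there are constants $c_7,c_8>0$ and $N$, depending only on $p$ and $\rho$, such that for all $n\ge N$, all $m\ge c_7n$, every fixed $T$ with $|T|\le\rho m$ and every fixed sign pattern $s$ on $T$, with probability at least $1-e^{-c_8n}$ the matrix $A$ recovers by $\ell_p$ on $(T,s)$. 2. (Sharpness of $2/3$.) For every $p\in(0,1)$ and every $\rho>\tfrac23$ there are constants $c>0$ and $M$, depending only on $p$ and $\rho$, such that for all $m\ge M$, all $n\ge1$, every fixed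 $T$ with $|T|\ge\rho m$ and every fixed sign pattern $s$ on $T$, with probability at least $1-e^{-cm}$ the matrix $A$ does not recover by $\ell_p$ on $(T,s)$. 3. (Contrast: threshold $1$ for $\ell_1$.) For every $\rho<1$ there are constants $c_7,c_8>0$ and $N$, depending only on $\rho$, such that for all $n\ge N$, all $m\ge c_7n$, every fixed $T$ with $|T|\le\rho m$ and every fixed sign pattern $s$ on $T$, with probability at least $1-e^{-c_8n}$ the matrix $A$ recovers by $\ell_1$ on $(T,s)$. -/

import Mathlib

open MeasureTheory ProbabilityTheory

/-- The law of the array of entries of an `m × n` real matrix with i.i.d. `N(0,1)` entries: the product, over all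
pairs `(i, j)`, of the standard Gaussian measure. -/
noncomputable def gaussianMatrixLaw (m n : ℕ) : Measure (Fin m → Fin n → ℝ) :=
  Measure.pi fun _ : Fin m => Measure.pi fun _ : Fin n => gaussianReal 0 1

instance gaussianMatrixLaw_isProbabilityMeasure (m n : ℕ) :
    IsProbabilityMeasure (gaussianMatrixLaw m n) :=
  inferInstanceAs (IsProbabilityMeasure
    (Measure.pi fun _ : Fin m => Measure.pi fun _ : Fin n => gaussianReal 0 1))

/-- `‖v‖_p^p = ∑ i, |v i| ^ p`. -/
noncomputable def lpCost {m : ℕ} (p : ℝ) (v : Fin m → ℝ) : ℝ :=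
  ∑ i, |v i| ^ p

/-- `f` is the unique solution of `min_x ‖y - A x‖_p^p`: every other point has strictly
larger cost. -/
def IsUniqueLpSolution {m n : ℕ} (p : ℝ) (A : Matrix (Fin m) (Fin n) ℝ) (y : Fin m → ℝ)
    (f : Fin n → ℝ) : Prop :=
  ∀ x : Fin n → ℝ, x ≠ f → lpCost p (y - A.mulVec f) < lpCost p (y - A.mulVec x)

/-- The vector `e` has support exactly `T`, and for `i ∈ T` the entry `e i` has the sign
`s i ∈ {1, -1}` (the values of `s` outside `T` play no role). -/
def HasSupportAndSigns {m : ℕ} (e : Fin m → ℝ) (T : Finset (Fin m)) (s : Fin m → ℤˣ) : Prop :=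
  (∀ i, e i ≠ 0 ↔ i ∈ T) ∧ ∀ i ∈ T, 0 < ((s i : ℤ) : ℝ) * e i

/-- Successful recovery for the support `T` and the sign pattern `s`: for every `f` and every
error `e` with support `T` and signs `s` on `T`, the vector `f` is the unique solution of
`ℓ_p`-minimization from the corrupted measurements `y = A f + e`. -/
def RecoversAll {m n : ℕ} (p : ℝ) (A : Matrix (Fin m) (Fin n) ℝ) (T : Finset (Fin m))
    (s : Fin m → ℤˣ) : Prop :=
  ∀ (f : Fin n → ℝ) (e : Fin m → ℝ), HasSupportAndSigns e T s →
    IsUniqueLpSolution p A (A.mulVec f + e) f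

/-!
Fix a support `T`, signs `s` and a matrix `A`, and replace `f` by `f + z`. The cost increases by
`∑ i, (|e i - (A z) i| ^ p - |e i| ^ p)`. For `p < 1` the decrease that an admissible error `e` can
cause at an index `i ∈ T` is at most `|(A z) i| ^ p` if `(A z) i` has the sign `s i`, with equality
for `e i = (A z) i`, and otherwise it is at most `0`, but arbitrarily close to `0` when `|e i|` is
large. Outside `T` there is an increase of `|(A z) i| ^ p`. Up to the boundary case, recovery is
therefore equivalent to negativity, for all `z ≠ 0`, of `∑ i, signedGain p T s i ((A z) i)`
(`recoversAll_of_sum_signedGain_neg`, `sum_signedGain_nonpos_of_recoversAll`).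

For a fixed unit vector `z` the `(A z) i` are i.i.d. standard Gaussians. By symmetry half of the
entries in `T` agree with the signs on average, so the mean of the sum is
`(3 / 2 * |T| - m) * E |g| ^ p` (`sum_integral_signedGain`), which changes sign at `|T| = 2 / 3 * m`.
For `p = 1` a disagreement of signs costs `|(A z) i|` however large the error is; the terms in `T`
then have mean `0`, and the threshold is `|T| = m` (`sum_integral_linearSignedGain`).

Sums of independent functions of Gaussians of linear growth concentrate exponentially
(`exists_measure_sum_ge_le`). Above the threshold, this applied to one direction `z` shows failure.
Below the threshold, it is applied to the at most `(1 + 2 / ε) ^ n` points of an `ε`-net of the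
sphere, with a fixed `ε`, which is affordable when `m` is a large multiple of `n`. To pass from the
net to the sphere, note that the gains are `p`-Hölder, so moving `z` to a net point `y` changes the
sum by at most `‖A (z - y)‖_p^p`. Since `‖A w‖_p^p` is `p`-homogeneous and subadditive in `w`, its
maximum over the sphere is controlled by its maximum over the same net (`sum_abs_rpow_le_of_net`),
so no bound on the singular values of `A` is needed.
-/

/-! ### Nets of small cardinality -/

theorem card_le_of_separated_of_norm_le_one {E : Type*} [NormedAddCommGroup E] [NormedSpace ℝ E]
    [FiniteDimensional ℝ E] {ε : ℝ} (hε : 0 < ε) (s : Finset E) (hs : ∀ c ∈ s, ‖c‖ ≤ 1)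
    (h : (s : Set E).Pairwise fun c d => ε ≤ dist c d) :
    (s.card : ℝ) ≤ (1 + 2 / ε) ^ Module.finrank ℝ E := by
  borelize E
  let μ : Measure E := Measure.addHaar
  set d := Module.finrank ℝ E
  have hδ : 0 < ε / 2 := by positivity
  have hρ : 0 < 1 + ε / 2 := by positivity
  have D : (s : Set E).Pairwise (Function.onFun Disjoint fun c => Metric.ball c (ε / 2)) := by
    intro c hc d hd hcd
    exact Metric.ball_disjoint_ball (by linarith [h hc hd hcd])
  have hsub : (⋃ c ∈ s, Metric.ball c (ε / 2)) ⊆ Metric.ball (0 : E) (1 + ε / 2) := by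
    refine Set.iUnion₂_subset fun x hx => Metric.ball_subset_ball' ?_
    rw [dist_zero_right]
    linarith [hs x hx]
  have hvol : (s.card : ENNReal) * ENNReal.ofReal ((ε / 2) ^ d) * μ (Metric.ball 0 1) ≤
      ENNReal.ofReal ((1 + ε / 2) ^ d) * μ (Metric.ball 0 1) := by
    calc (s.card : ENNReal) * ENNReal.ofReal ((ε / 2) ^ d) * μ (Metric.ball 0 1)
        = μ (⋃ c ∈ s, Metric.ball c (ε / 2)) := by
          rw [measure_biUnion_finset D fun c _ => measurableSet_ball]
          simp only [μ.addHaar_ball_of_pos _ hδ, Finset.sum_const, nsmul_eq_mul, mul_assoc, d]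
      _ ≤ μ (Metric.ball (0 : E) (1 + ε / 2)) := measure_mono hsub
      _ = _ := by rw [μ.addHaar_ball_of_pos _ hρ]
  have hcard : (s.card : ENNReal) * ENNReal.ofReal ((ε / 2) ^ d) ≤
      ENNReal.ofReal ((1 + ε / 2) ^ d) :=
    (ENNReal.mul_le_mul_iff_left (Metric.measure_ball_pos _ _ zero_lt_one).ne'
      measure_ball_lt_top.ne).1 hvol
  have hreal := ENNReal.toReal_le_of_le_ofReal (pow_nonneg hρ.le _) hcard
  rw [ENNReal.toReal_mul, ENNReal.toReal_natCast, ENNReal.toReal_ofReal (by positivity)] at hreal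
  rw [show 1 + 2 / ε = (1 + ε / 2) / (ε / 2) by field_simp; ring, div_pow]
  exact (le_div_iff₀ (by positivity)).2 hreal

/-- Volumetric bound for nets: a subset of the unit ball of a normed space of dimension `d` has a
finite `ε`-net, made of points of the subset, of cardinality at most `(1 + 2 / ε) ^ d`. -/
theorem exists_finset_net_card_le {E : Type*} [NormedAddCommGroup E] [NormedSpace ℝ E]
    [FiniteDimensional ℝ E] {ε : ℝ} (hε : 0 < ε) (A : Set E) (hA : ∀ x ∈ A, ‖x‖ ≤ 1) :
    ∃ N : Finset E, (N.card : ℝ) ≤ (1 + 2 / ε) ^ Module.finrank ℝ E ∧ (∀ x ∈ N, x ∈ A) ∧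
      ∀ x ∈ A, ∃ y ∈ N, dist x y ≤ ε := by
  lift ε to NNReal using hε.le
  have hcard : ∀ s : Finset E, (s : Set E) ⊆ A → Metric.IsSeparated (ε : ENNReal) (s : Set E) →
      (s.card : ℝ) ≤ (1 + 2 / (ε : ℝ)) ^ Module.finrank ℝ E := by
    intro s hsA hs
    refine card_le_of_separated_of_norm_le_one hε s (fun c hc => hA c (hsA hc)) ?_
    intro c hc d hd hcd
    have : (ε : ENNReal) < edist c d := hs hc hd hcd
    rw [edist_nndist, ENNReal.coe_lt_coe] at this
    exact_mod_cast this.le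
  have hpack : Metric.packingNumber ε A ≠ ⊤ := by
    set K := ⌊(1 + 2 / (ε : ℝ)) ^ Module.finrank ℝ E⌋₊
    refine ne_top_of_le_ne_top (ENat.natCast_ne_top K) ?_
    refine iSup₂_le fun C hC => iSup_le fun hsep => ?_
    by_contra! hlt
    obtain ⟨t, htC, ht⟩ := Set.exists_subset_encard_eq (Order.add_one_le_of_lt hlt)
    have htfin : t.Finite := Set.finite_of_encard_eq_coe (k := K + 1) (by simpa using ht)
    have hle := hcard htfin.toFinset (by simpa using htC.trans hC)
      (by rw [htfin.coe_toFinset]; exact hsep.mono htC)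
    rw [← Nat.le_floor_iff (by positivity)] at hle
    rw [htfin.encard_eq_coe_toFinset_card] at ht
    have : htfin.toFinset.card = K + 1 := by exact_mod_cast ht
    omega
  have hfin : (Metric.maximalSeparatedSet ε A).Finite := by
    rw [← Set.encard_ne_top_iff, Metric.encard_maximalSeparatedSet hpack]
    exact hpack
  refine ⟨hfin.toFinset, hcard _ (by simpa using Metric.maximalSeparatedSet_subset)
    (by simpa using Metric.isSeparated_maximalSeparatedSet),
    fun x hx => Metric.maximalSeparatedSet_subset (by simpa using hx), fun x hx => ?_⟩
  obtain ⟨y, hy, hxy⟩ := Metric.isCover_maximalSeparatedSet hpack hx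
  refine ⟨y, by simpa using hy, ?_⟩
  have h2 : edist x y ≤ ε := hxy
  rw [edist_nndist, ENNReal.coe_le_coe] at h2
  exact_mod_cast h2

/-! ### Images of a fixed vector under a Gaussian matrix -/

/-- Rotation invariance in its one-dimensional form: a linear combination of i.i.d. standard
Gaussians with coefficients of unit Euclidean norm is again standard Gaussian. -/
theorem map_dotProduct_pi_gaussianReal {n : ℕ} {z : Fin n → ℝ} (hz : ∑ j, z j ^ 2 = 1) :
    (Measure.pi fun _ : Fin n => gaussianReal 0 1).map (fun x => ∑ j, x j * z j) =
      gaussianReal 0 1 := by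
  have hm : Measurable fun x : Fin n → ℝ => ∑ j, x j * z j := by fun_prop
  have : IsProbabilityMeasure ((Measure.pi fun _ : Fin n => gaussianReal 0 1).map
      (fun x => ∑ j, x j * z j)) := Measure.isProbabilityMeasure_map hm.aemeasurable
  refine Measure.ext_of_charFun ?_
  ext t
  rw [charFun_apply_real, integral_map hm.aemeasurable (by fun_prop)]
  have hprod : ∀ x : Fin n → ℝ, Complex.exp (t * ((∑ j, x j * z j : ℝ) : ℂ) * Complex.I) =
      ∏ j, Complex.exp (((t * z j : ℝ) : ℂ) * (x j : ℂ) * Complex.I) := by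
    intro x
    rw [← Complex.exp_sum]
    congr 1
    push_cast
    rw [Finset.mul_sum, Finset.sum_mul]
    exact Finset.sum_congr rfl fun j _ => by ring
  simp_rw [hprod]
  rw [integral_fintype_prod_eq_prod (fun (j : Fin n) (y : ℝ) =>
    Complex.exp (((t * z j : ℝ) : ℂ) * (y : ℂ) * Complex.I))]
  simp_rw [← charFun_apply_real, charFun_gaussianReal]
  rw [← Complex.exp_sum]
  congr 1
  have hz' : ∑ j, (z j : ℂ) ^ 2 = 1 := by exact_mod_cast hz
  simp only [Complex.ofReal_zero, mul_zero, zero_mul, zero_sub, NNReal.coe_one, Complex.ofReal_one,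
    one_mul, Complex.ofReal_mul, mul_pow]
  rw [Finset.sum_neg_distrib, ← Finset.sum_div, ← Finset.mul_sum, hz', mul_one]

/-- The image of a fixed unit vector under a Gaussian matrix is a standard Gaussian vector. -/
theorem map_mulVec_gaussianMatrixLaw (m : ℕ) {n : ℕ} {z : Fin n → ℝ} (hz : ∑ j, z j ^ 2 = 1) :
    (gaussianMatrixLaw m n).map (fun a => (Matrix.of a).mulVec z) =
      Measure.pi fun _ : Fin m => gaussianReal 0 1 := by
  have hm : Measurable fun x : Fin n → ℝ => ∑ j, x j * z j := by fun_prop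
  have h := Measure.pi_map_pi (μ := fun _ : Fin m => Measure.pi fun _ : Fin n => gaussianReal 0 1)
    (f := fun _ x => ∑ j, x j * z j)
    (hμ := fun _ => by rw [map_dotProduct_pi_gaussianReal hz]; infer_instance)
    (fun _ => hm.aemeasurable)
  simp_rw [map_dotProduct_pi_gaussianReal hz] at h
  exact h

/-! ### A Chernoff bound for functions of linear growth -/

theorem Real.exp_le_one_add_self_add_sq_mul_exp_abs (x : ℝ) :
    Real.exp x ≤ 1 + x + x ^ 2 * Real.exp |x| := by
  have h := Complex.norm_exp_sub_sum_le_norm_mul_exp (x : ℂ) 2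
  have h2 : Complex.exp x - ∑ m ∈ Finset.range 2, (x : ℂ) ^ m / (m.factorial : ℂ) =
      ((Real.exp x - (1 + x) : ℝ) : ℂ) := by
    simp [Finset.sum_range_succ]
  rw [h2, Complex.norm_real, Complex.norm_real, Real.norm_eq_abs, Real.norm_eq_abs, sq_abs] at h
  linarith [le_abs_self (Real.exp x - (1 + x))]

/-- An integrable weight dominating the second-order terms of the exponential series of every
function bounded by `1 + |t|`. -/
noncomputable def expWeight (t : ℝ) : ℝ :=
  2 * Real.exp 2 * (Real.exp (2 * t) + Real.exp (-2 * t))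

theorem integrable_expWeight : Integrable expWeight (gaussianReal 0 1) :=
  ((integrable_exp_mul_gaussianReal 2).add (integrable_exp_mul_gaussianReal (-2))).const_mul _

theorem exp_two_mul_abs_le (t : ℝ) :
    Real.exp (2 * |t|) ≤ Real.exp (2 * t) + Real.exp (-2 * t) := by
  rcases abs_cases t with ⟨h, -⟩ | ⟨h, -⟩
  · rw [h]; linarith [Real.exp_pos (-2 * t)]
  · rw [h, mul_neg, ← neg_mul]; linarith [Real.exp_pos (2 * t)]

theorem sq_mul_exp_le_expWeight (t : ℝ) :
    (1 + |t|) ^ 2 * Real.exp (1 + |t|) ≤ expWeight t := by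
  have h1 : (1 + |t|) ^ 2 ≤ 2 * Real.exp (1 + |t|) := by
    have := Real.quadratic_le_exp_of_nonneg (x := 1 + |t|) (by positivity)
    nlinarith [abs_nonneg t]
  calc (1 + |t|) ^ 2 * Real.exp (1 + |t|)
      ≤ 2 * Real.exp (1 + |t|) * Real.exp (1 + |t|) := by gcongr
    _ = 2 * Real.exp 2 * Real.exp (2 * |t|) := by
        rw [mul_assoc, mul_assoc, ← Real.exp_add, ← Real.exp_add]; ring_nf
    _ ≤ expWeight t := by
        unfold expWeight
        gcongr
        exact exp_two_mul_abs_le t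

theorem expWeight_nonneg (t : ℝ) : 0 ≤ expWeight t := by
  unfold expWeight; positivity

theorem one_add_abs_le_expWeight (t : ℝ) : 1 + |t| ≤ expWeight t := by
  refine le_trans ?_ (sq_mul_exp_le_expWeight t)
  have h1 : 1 ≤ Real.exp (1 + |t|) := Real.one_le_exp (by positivity)
  nlinarith [abs_nonneg t, sq_nonneg (1 + |t|)]

theorem integrable_of_abs_le_one_add_abs {ψ : ℝ → ℝ} (hm : Measurable ψ)
    (hψ : ∀ t, |ψ t| ≤ 1 + |t|) : Integrable ψ (gaussianReal 0 1) :=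
  integrable_expWeight.mono' hm.aestronglyMeasurable
    (ae_of_all _ fun t => (hψ t).trans (one_add_abs_le_expWeight t))

theorem exp_mul_le_of_abs_le_one_add_abs {x t l : ℝ} (hx : |x| ≤ 1 + |t|) (hl : 0 ≤ l)
    (hl1 : l ≤ 1) : Real.exp (l * x) ≤ 1 + l * x + l ^ 2 * expWeight t := by
  refine (Real.exp_le_one_add_self_add_sq_mul_exp_abs _).trans ?_
  have h1 : |l * x| ≤ 1 + |t| := by
    rw [abs_mul, abs_of_nonneg hl]
    nlinarith [abs_nonneg x]
  have h2 : x ^ 2 ≤ (1 + |t|) ^ 2 := by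
    rw [← sq_abs x]; gcongr
  have h3 : (l * x) ^ 2 * Real.exp |l * x| ≤ l ^ 2 * expWeight t := by
    calc (l * x) ^ 2 * Real.exp |l * x| ≤ l ^ 2 * (1 + |t|) ^ 2 * Real.exp (1 + |t|) := by
          rw [mul_pow]; gcongr
      _ ≤ _ := by rw [mul_assoc]; gcongr; exact sq_mul_exp_le_expWeight t
  linarith

theorem integrable_exp_mul_of_abs_le_one_add_abs {ψ : ℝ → ℝ} (hm : Measurable ψ)
    (hψ : ∀ t, |ψ t| ≤ 1 + |t|) {l : ℝ} (hl : 0 ≤ l) (hl1 : l ≤ 1) :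
    Integrable (fun t => Real.exp (l * ψ t)) (gaussianReal 0 1) := by
  have hi := integrable_of_abs_le_one_add_abs hm hψ
  refine (((integrable_const 1).add (hi.const_mul l)).add
    (integrable_expWeight.const_mul (l ^ 2))).mono' (by fun_prop) (ae_of_all _ fun t => ?_)
  rw [Real.norm_of_nonneg (Real.exp_pos _).le]
  exact exp_mul_le_of_abs_le_one_add_abs (hψ t) hl hl1

theorem integral_exp_mul_le {ψ : ℝ → ℝ} (hm : Measurable ψ)
    (hψ : ∀ t, |ψ t| ≤ 1 + |t|) {l : ℝ} (hl : 0 ≤ l) (hl1 : l ≤ 1) :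
    ∫ t, Real.exp (l * ψ t) ∂gaussianReal 0 1 ≤
      Real.exp (l * ∫ t, ψ t ∂gaussianReal 0 1 +
        l ^ 2 * ∫ t, expWeight t ∂gaussianReal 0 1) := by
  have hi := integrable_of_abs_le_one_add_abs hm hψ
  have hi1 : Integrable (fun t => 1 + l * ψ t) (gaussianReal 0 1) :=
    (integrable_const 1).add (hi.const_mul l)
  calc ∫ t, Real.exp (l * ψ t) ∂gaussianReal 0 1
      ≤ ∫ t, (1 + l * ψ t + l ^ 2 * expWeight t) ∂gaussianReal 0 1 :=
        integral_mono (integrable_exp_mul_of_abs_le_one_add_abs hm hψ hl hl1)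
          (hi1.add (integrable_expWeight.const_mul (l ^ 2)))
          fun t => exp_mul_le_of_abs_le_one_add_abs (hψ t) hl hl1
    _ = 1 + l * ∫ t, ψ t ∂gaussianReal 0 1 + l ^ 2 * ∫ t, expWeight t ∂gaussianReal 0 1 := by
        rw [integral_add hi1 (integrable_expWeight.const_mul (l ^ 2)),
          integral_add (integrable_const 1) (hi.const_mul l), integral_const_mul,
          integral_const_mul]
        simp
    _ ≤ _ := by
        refine le_trans (le_of_eq ?_) (Real.add_one_le_exp _)
        ring

/-- Chernoff bound for a sum of independent, not identically distributed, functions of standard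
Gaussians. The rate `c` depends only on the gap `d` between the threshold and the mean, not on the
functions, which only have to satisfy the common growth bound `|ψ i t| ≤ 1 + |t|`. -/
theorem exists_measure_sum_ge_le {d : ℝ} (hd : 0 < d) :
    ∃ c : ℝ, 0 < c ∧ ∀ (m : ℕ) (ψ : Fin m → ℝ → ℝ) (b : ℝ), (∀ i, Measurable (ψ i)) →
      (∀ i t, |ψ i t| ≤ 1 + |t|) →
      ∑ i, ∫ t, ψ i t ∂gaussianReal 0 1 ≤ (b - d) * m →
      (Measure.pi fun _ : Fin m => gaussianReal 0 1).real {v | b * m ≤ ∑ i, ψ i (v i)} ≤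
        Real.exp (-c * m) := by
  set C := ∫ t, expWeight t ∂gaussianReal 0 1
  have hC : 0 ≤ C := integral_nonneg expWeight_nonneg
  -- The exponent `-l * d + l ^ 2 * C` is at most `-l * d / 2` for this choice of `l`.
  set l := min 1 (d / (2 * (C + 1)))
  have hl : 0 < l := lt_min one_pos (by positivity)
  have hl1 : l ≤ 1 := min_le_left _ _
  have hlC : l * C ≤ d / 2 := by
    have : l * (2 * (C + 1)) ≤ d := (le_div_iff₀ (by positivity)).1 (min_le_right _ _)
    nlinarith
  refine ⟨l * d / 2, by positivity, fun m ψ b hm hψ hmean => ?_⟩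
  have hexp : ∀ v : Fin m → ℝ, Real.exp (l * ∑ i, ψ i (v i)) = ∏ i, Real.exp (l * ψ i (v i)) := by
    intro v
    rw [Finset.mul_sum, Real.exp_sum]
  have hint : Integrable (fun v : Fin m → ℝ => Real.exp (l * ∑ i, ψ i (v i)))
      (Measure.pi fun _ : Fin m => gaussianReal 0 1) := by
    simp_rw [hexp]
    exact Integrable.fintype_prod (f := fun i t => Real.exp (l * ψ i t))
      fun i => integrable_exp_mul_of_abs_le_one_add_abs (hm i) (hψ i) hl.le hl1
  refine (measure_ge_le_exp_mul_mgf (b * m) hl.le hint).trans ?_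
  unfold mgf
  simp_rw [hexp]
  rw [integral_fintype_prod_eq_prod (fun (i : Fin m) t => Real.exp (l * ψ i t))]
  calc Real.exp (-l * (b * m)) * ∏ i, ∫ t, Real.exp (l * ψ i t) ∂gaussianReal 0 1
      ≤ Real.exp (-l * (b * m)) *
          ∏ i, Real.exp (l * ∫ t, ψ i t ∂gaussianReal 0 1 + l ^ 2 * C) := by
        refine mul_le_mul_of_nonneg_left (Finset.prod_le_prod ?_ ?_) (Real.exp_pos _).le
        · exact fun i _ => integral_nonneg fun t => (Real.exp_pos (l * ψ i t)).le
        · exact fun i _ => integral_exp_mul_le (hm i) (hψ i) hl.le hl1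
    _ = Real.exp (-l * (b * m) +
          (l * ∑ i, ∫ t, ψ i t ∂gaussianReal 0 1 + m * (l ^ 2 * C))) := by
        rw [← Real.exp_sum, ← Real.exp_add, Finset.sum_add_distrib, ← Finset.mul_sum]
        simp
    _ ≤ Real.exp (-(l * d / 2) * m) := by
        refine Real.exp_le_exp.2 ?_
        have h1 := mul_le_mul_of_nonneg_left hmean hl.le
        have h2 := mul_le_mul_of_nonneg_left hlC (mul_nonneg hl.le (Nat.cast_nonneg (α := ℝ) m))
        linarith

/-! ### Hölder functions homogeneous of degree `p` -/

theorem abs_rpow_sub_abs_rpow_le {p : ℝ} (hp : 0 < p) (hp1 : p ≤ 1) (s t : ℝ) :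
    |s| ^ p - |t| ^ p ≤ |s - t| ^ p := by
  have h1 : |s| ≤ |t| + |s - t| := by
    have := abs_add_le t (s - t)
    rwa [add_sub_cancel] at this
  have h2 : |s| ^ p ≤ (|t| + |s - t|) ^ p := Real.rpow_le_rpow (abs_nonneg _) h1 hp.le
  linarith [Real.rpow_add_le_add_rpow (abs_nonneg t) (abs_nonneg (s - t)) hp.le hp1]

theorem abs_rpow_le_one_add_abs {p : ℝ} (hp : 0 < p) (hp1 : p ≤ 1) (t : ℝ) :
    |t| ^ p ≤ 1 + |t| := by
  rcases le_total |t| 1 with h | h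
  · linarith [Real.rpow_le_one (abs_nonneg t) h hp.le, abs_nonneg t]
  · have := Real.rpow_le_rpow_of_exponent_le h hp1
    rw [Real.rpow_one] at this
    linarith

/-- The real functions that are `p`-Hölder with constant `1` and positively homogeneous of degree
`p`. -/
structure IsHolderHomogeneous (p : ℝ) (ψ : ℝ → ℝ) : Prop where
  continuous : Continuous ψ
  sub_le : ∀ s t, ψ s - ψ t ≤ |s - t| ^ p
  map_mul : ∀ c t, 0 < c → ψ (c * t) = c ^ p * ψ t

theorem isHolderHomogeneous_abs_rpow {p : ℝ} (hp : 0 < p) (hp1 : p ≤ 1) :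
    IsHolderHomogeneous p fun t => |t| ^ p where
  continuous := continuous_abs.rpow_const fun _ => Or.inr hp.le
  sub_le := abs_rpow_sub_abs_rpow_le hp hp1
  map_mul c t hc := by rw [abs_mul, abs_of_pos hc, Real.mul_rpow hc.le (abs_nonneg t)]

namespace IsHolderHomogeneous

theorem map_zero {p : ℝ} {ψ : ℝ → ℝ} (h : IsHolderHomogeneous p ψ) (hp : 0 < p) : ψ 0 = 0 := by
  have h1 := h.map_mul 2 0 two_pos
  rw [mul_zero] at h1
  have h2 : (1 : ℝ) < 2 ^ p := Real.one_lt_rpow one_lt_two hp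
  have h3 : (2 ^ p - 1) * ψ 0 = 0 := by linarith
  rcases mul_eq_zero.1 h3 with h4 | h4
  · linarith
  · exact h4

theorem abs_le {p : ℝ} {ψ : ℝ → ℝ} (h : IsHolderHomogeneous p ψ) (hp : 0 < p) (t : ℝ) :
    |ψ t| ≤ |t| ^ p := by
  have h1 := h.sub_le t 0
  have h2 := h.sub_le 0 t
  rw [h.map_zero hp] at h1 h2
  rw [zero_sub, zero_sub, abs_neg] at h2
  rw [sub_zero, sub_zero] at h1
  exact _root_.abs_le.2 ⟨by linarith, by linarith⟩

theorem abs_le_one_add_abs {p : ℝ} {ψ : ℝ → ℝ} (h : IsHolderHomogeneous p ψ) (hp : 0 < p)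
    (hp1 : p ≤ 1) (t : ℝ) : |ψ t| ≤ 1 + |t| :=
  (h.abs_le hp t).trans (abs_rpow_le_one_add_abs hp hp1 t)

theorem neg {p : ℝ} {ψ : ℝ → ℝ} (h : IsHolderHomogeneous p ψ) :
    IsHolderHomogeneous p fun t => -ψ t where
  continuous := h.continuous.neg
  sub_le s t := by
    have := h.sub_le t s
    rw [abs_sub_comm] at this
    linarith
  map_mul c t hc := by rw [h.map_mul c t hc, mul_neg]

end IsHolderHomogeneous

/-! ### Passing from a net to all directions -/

section Net

variable {E : Type*} [NormedAddCommGroup E] [NormedSpace ℝ E] {m : ℕ}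

theorem sum_map_smul {p : ℝ} {ψ : Fin m → ℝ → ℝ} (hψ : ∀ i, IsHolderHomogeneous p (ψ i))
    (A : E →ₗ[ℝ] Fin m → ℝ) {c : ℝ} (hc : 0 < c) (z : E) :
    ∑ i, ψ i (A (c • z) i) = c ^ p * ∑ i, ψ i (A z i) := by
  rw [Finset.mul_sum]
  refine Finset.sum_congr rfl fun i _ => ?_
  rw [map_smul, Pi.smul_apply, smul_eq_mul, (hψ i).map_mul c _ hc]

theorem sum_map_le_add_sum_abs_rpow {p : ℝ} {ψ : Fin m → ℝ → ℝ}
    (hψ : ∀ i, IsHolderHomogeneous p (ψ i)) (A : E →ₗ[ℝ] Fin m → ℝ) (y z : E) :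
    ∑ i, ψ i (A z i) ≤ ∑ i, ψ i (A y i) + ∑ i, |A (z - y) i| ^ p := by
  rw [← Finset.sum_add_distrib]
  refine Finset.sum_le_sum fun i _ => ?_
  have := (hψ i).sub_le (A z i) (A y i)
  rw [map_sub, Pi.sub_apply]
  linarith

/-- A bound for `‖A z‖_p^p` on a sufficiently fine net of the unit sphere extends, up to a factor
`2`, to the whole space: the maximum over the sphere is at most the maximum over the net plus half
of itself. -/
theorem sum_abs_rpow_le_of_net [FiniteDimensional ℝ E] {p : ℝ} (hp : 0 < p) (hp1 : p ≤ 1)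
    (A : E →ₗ[ℝ] Fin m → ℝ) {N : Finset E} {ε B : ℝ} (hεp : ε ^ p ≤ 1 / 2)
    (hN : ∀ x ∈ Metric.sphere (0 : E) 1, ∃ y ∈ N, dist x y ≤ ε)
    (hB : ∀ y ∈ N, ∑ i, |A y i| ^ p ≤ B) (w : E) :
    ∑ i, |A w i| ^ p ≤ 2 * B * ‖w‖ ^ p := by
  have hψ : ∀ _ : Fin m, IsHolderHomogeneous p fun t => |t| ^ p :=
    fun _ => isHolderHomogeneous_abs_rpow hp hp1
  rcases eq_or_ne w 0 with rfl | hw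
  · simp [Real.zero_rpow hp.ne']
  have : Nontrivial E := ⟨w, 0, hw⟩
  have hcont : Continuous fun z : E => ∑ i, |A z i| ^ p := by
    have hA : Continuous A := A.continuous_of_finiteDimensional
    exact continuous_finsetSum _ fun i _ =>
      (hψ i).continuous.comp ((continuous_apply i).comp hA)
  obtain ⟨x, hx, hmax⟩ := (isCompact_sphere (0 : E) 1).exists_isMaxOn
    (NormedSpace.sphere_nonempty.2 zero_le_one) hcont.continuousOn
  have hscale : ∀ u : E, ∑ i, |A u i| ^ p ≤ ‖u‖ ^ p * ∑ i, |A x i| ^ p := by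
    intro u
    rcases eq_or_ne u 0 with rfl | hu
    · simp [Real.zero_rpow hp.ne']
    have hu0 : 0 < ‖u‖ := norm_pos_iff.2 hu
    have hs : ‖u‖⁻¹ • u ∈ Metric.sphere (0 : E) 1 := by
      simp [norm_smul, hu0.ne']
    have h1 := sum_map_smul hψ A hu0 (‖u‖⁻¹ • u)
    rw [smul_inv_smul₀ hu0.ne'] at h1
    rw [h1]
    exact mul_le_mul_of_nonneg_left (hmax hs) (by positivity)
  obtain ⟨y, hy, hxy⟩ := hN x hx
  have h1 := sum_map_le_add_sum_abs_rpow hψ A y x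
  have h2 := hscale (x - y)
  have h0 : 0 ≤ ∑ i, |A x i| ^ p := Finset.sum_nonneg fun i _ => by positivity
  have h3 : ‖x - y‖ ^ p ≤ 1 / 2 := by
    rw [← dist_eq_norm]
    exact (Real.rpow_le_rpow dist_nonneg hxy hp.le).trans hεp
  have h4 := mul_le_mul_of_nonneg_right h3 h0
  have h5 : ∑ i, |A x i| ^ p ≤ 2 * B := by linarith [hB y hy]
  calc _ ≤ ‖w‖ ^ p * ∑ i, |A x i| ^ p := hscale w
    _ ≤ ‖w‖ ^ p * (2 * B) := by gcongr
    _ = _ := mul_comm _ _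

/-- Negativity with a margin on a sufficiently fine net of the unit sphere implies negativity in all
directions, since moving to the nearest net point changes the sum by at most `2 * B * ε ^ p`. -/
theorem sum_map_neg_of_net [FiniteDimensional ℝ E] {p : ℝ} (hp : 0 < p) (hp1 : p ≤ 1)
    {ψ : Fin m → ℝ → ℝ} (hψ : ∀ i, IsHolderHomogeneous p (ψ i))
    (A : E →ₗ[ℝ] Fin m → ℝ) {N : Finset E} {ε B D : ℝ} (hεp : ε ^ p ≤ 1 / 2)
    (hN : ∀ x ∈ Metric.sphere (0 : E) 1, ∃ y ∈ N, dist x y ≤ ε)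
    (hB : ∀ y ∈ N, ∑ i, |A y i| ^ p ≤ B) (hD : ∀ y ∈ N, ∑ i, ψ i (A y i) < -D)
    (hBD : 2 * B * ε ^ p ≤ D) {z : E} (hz : z ≠ 0) :
    ∑ i, ψ i (A z i) < 0 := by
  have hz0 : 0 < ‖z‖ := norm_pos_iff.2 hz
  set u := ‖z‖⁻¹ • z
  have hu : u ∈ Metric.sphere (0 : E) 1 := by simp [u, norm_smul, hz0.ne']
  obtain ⟨y, hy, huy⟩ := hN u hu
  have hB0 : 0 ≤ B := (Finset.sum_nonneg fun i _ => by positivity).trans (hB y hy)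
  have h1 := sum_map_le_add_sum_abs_rpow hψ A y u
  have h2 := sum_abs_rpow_le_of_net hp hp1 A hεp hN hB (u - y)
  have h3 : 2 * B * ‖u - y‖ ^ p ≤ 2 * B * ε ^ p := by
    rw [← dist_eq_norm]
    gcongr
  have h4 : ∑ i, ψ i (A u i) < 0 := by linarith [hD y hy]
  have h5 := sum_map_smul hψ A hz0 u
  rw [smul_inv_smul₀ hz0.ne'] at h5
  rw [h5]
  exact mul_neg_of_pos_of_neg (by positivity) h4

end Net

/-! ### Chernoff bounds for a fixed direction and for all directions -/

theorem exists_measure_sum_mulVec_ge_le {d : ℝ} (hd : 0 < d) :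
    ∃ c : ℝ, 0 < c ∧ ∀ (m : ℕ) (ψ : Fin m → ℝ → ℝ) (b : ℝ), (∀ i, Measurable (ψ i)) →
      (∀ i t, |ψ i t| ≤ 1 + |t|) →
      ∑ i, ∫ t, ψ i t ∂gaussianReal 0 1 ≤ (b - d) * m →
      ∀ (n : ℕ) (z : Fin n → ℝ), ∑ j, z j ^ 2 = 1 →
      (gaussianMatrixLaw m n).real {a | b * m ≤ ∑ i, ψ i ((Matrix.of a).mulVec z i)} ≤
        Real.exp (-c * m) := by
  obtain ⟨c, hc, h⟩ := exists_measure_sum_ge_le hd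
  refine ⟨c, hc, fun m ψ b hm hψ hmean n z hz => ?_⟩
  refine le_of_eq_of_le ?_ (h m ψ b hm hψ hmean)
  have hmeas : Measurable fun a : Fin m → Fin n → ℝ => (Matrix.of a).mulVec z := by
    refine measurable_pi_lambda _ fun i => ?_
    simp only [Matrix.mulVec, dotProduct, Matrix.of_apply]
    fun_prop
  rw [← map_mulVec_gaussianMatrixLaw m hz, map_measureReal_apply hmeas]
  · rfl
  · exact measurableSet_le measurable_const
      (Finset.measurable_sum _ fun i _ => (hm i).comp (measurable_pi_apply i))

/-- Uniform version of the Chernoff bound: with `m` at least a large multiple of `n`, a sum of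
Hölder and homogeneous functions of the entries of `A z` whose mean is at most `-d * m` at unit
vectors is negative simultaneously for all `z ≠ 0`. -/
theorem exists_measure_exists_sum_mulVec_nonneg_le {p : ℝ} (hp : 0 < p) (hp1 : p ≤ 1) {d : ℝ}
    (hd : 0 < d) :
    ∃ C : ℝ, 0 < C ∧ ∀ n : ℕ, 1 ≤ n → ∀ m : ℕ, C * n ≤ m → ∀ ψ : Fin m → ℝ → ℝ,
      (∀ i, IsHolderHomogeneous p (ψ i)) →
      ∑ i, ∫ t, ψ i t ∂gaussianReal 0 1 ≤ -d * m →
      (gaussianMatrixLaw m n).real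
        {a | ∃ z : Fin n → ℝ, z ≠ 0 ∧ 0 ≤ ∑ i, ψ i ((Matrix.of a).mulVec z i)} ≤
        Real.exp (-n) := by
  obtain ⟨c₁, hc₁, h₁⟩ := exists_measure_sum_mulVec_ge_le (half_pos hd)
  obtain ⟨c₂, hc₂, h₂⟩ := exists_measure_sum_mulVec_ge_le one_pos
  set c := min c₁ c₂
  have hc : 0 < c := lt_min hc₁ hc₂
  set K := ∫ t, |t| ^ p ∂gaussianReal 0 1 + 1
  have hK : 1 ≤ K := by
    have : 0 ≤ ∫ t, |t| ^ p ∂gaussianReal 0 1 := integral_nonneg fun t => by positivity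
    linarith
  set θ := min (1 / 2) (d / (4 * K))
  have hθ : 0 < θ := lt_min (by norm_num) (by positivity)
  set ε := θ ^ p⁻¹
  have hε : 0 < ε := Real.rpow_pos_of_pos hθ _
  have hεp : ε ^ p = θ := Real.rpow_inv_rpow hθ.le hp.ne'
  have hθK : 4 * K * θ ≤ d := by
    have := (le_div_iff₀ (by positivity)).1 (min_le_right (1 / 2) (d / (4 * K)))
    linarith
  set L := 1 + 2 / ε
  have hL : 1 ≤ L := by
    have : 0 < 2 / ε := by positivity
    linarith
  have hlogL : 0 ≤ Real.log L := Real.log_nonneg hL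
  refine ⟨(2 + Real.log L) / c, by positivity, fun n hn m hmn ψ hψ hmean => ?_⟩
  obtain ⟨N, hcard, hsub, hnet⟩ := exists_finset_net_card_le hε
    (Metric.sphere (0 : EuclideanSpace ℝ (Fin n)) 1) (fun x hx => (by simpa using hx : ‖x‖ = 1).le)
  rw [finrank_euclideanSpace_fin] at hcard
  have hunit : ∀ y ∈ N, ∑ j, y j ^ 2 = 1 := by
    intro y hy
    have h1 : ‖y‖ = 1 := by simpa using hsub y hy
    have h2 := EuclideanSpace.norm_sq_eq y
    simp only [h1, Real.norm_eq_abs, sq_abs] at h2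
    linarith
  -- The exceptional events attached to a point of the net.
  set U : EuclideanSpace ℝ (Fin n) → Set (Fin m → Fin n → ℝ) := fun y =>
    {a | -(d / 2) * m ≤ ∑ i, ψ i ((Matrix.of a).mulVec y i)} ∪
      {a | K * m ≤ ∑ i, |(Matrix.of a).mulVec y i| ^ p}
  have hU : ∀ y ∈ N, (gaussianMatrixLaw m n).real (U y) ≤ 2 * Real.exp (-c * m) := by
    intro y hy
    have e1 : Real.exp (-c₁ * m) ≤ Real.exp (-c * m) := by
      have := min_le_left c₁ c₂
      gcongr
    have e2 : Real.exp (-c₂ * m) ≤ Real.exp (-c * m) := by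
      have := min_le_right c₁ c₂
      gcongr
    have b1 := h₁ m ψ (-(d / 2)) (fun i => (hψ i).continuous.measurable)
      (fun i => (hψ i).abs_le_one_add_abs hp hp1) (by linarith) n y (hunit y hy)
    have hG := isHolderHomogeneous_abs_rpow hp hp1
    have b2 := h₂ m (fun _ t => |t| ^ p) K (fun i => hG.continuous.measurable)
      (fun i => hG.abs_le_one_add_abs hp hp1) (by simp [K, mul_comm]) n y (hunit y hy)
    refine (measureReal_union_le _ _).trans ?_
    linarith
  have hincl : {a : Fin m → Fin n → ℝ | ∃ z : Fin n → ℝ, z ≠ 0 ∧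
      0 ≤ ∑ i, ψ i ((Matrix.of a).mulVec z i)} ⊆ ⋃ y ∈ N, U y := by
    rintro a ⟨z, hz, hza⟩
    by_contra hcon
    simp only [Set.mem_iUnion, not_exists, U, Set.mem_union, Set.mem_ofPred_eq, not_or,
      not_le] at hcon
    set A : EuclideanSpace ℝ (Fin n) →ₗ[ℝ] Fin m → ℝ :=
      (Matrix.mulVecLin (Matrix.of a)).comp (WithLp.linearEquiv 2 ℝ (Fin n → ℝ)).toLinearMap
    have hneg := sum_map_neg_of_net hp hp1 hψ A (N := N) (ε := ε) (B := K * m) (D := d / 2 * m)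
      (hεp.trans_le (min_le_left _ _)) hnet (fun y hy => (hcon y hy).2.le)
      (fun y hy => (hcon y hy).1.trans_eq (by ring))
      (by rw [hεp]; nlinarith [mul_le_mul_of_nonneg_right hθK (Nat.cast_nonneg (α := ℝ) m)])
      (z := WithLp.toLp 2 z) (by simpa using hz)
    exact absurd hza (not_le.2 hneg)
  calc (gaussianMatrixLaw m n).real _
      ≤ (gaussianMatrixLaw m n).real (⋃ y ∈ N, U y) := measureReal_mono hincl (measure_ne_top _ _)
    _ ≤ ∑ y ∈ N, (gaussianMatrixLaw m n).real (U y) := measureReal_biUnion_finset_le _ _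
    _ ≤ ∑ _y ∈ N, 2 * Real.exp (-c * m) := Finset.sum_le_sum hU
    _ = N.card * (2 * Real.exp (-c * m)) := by rw [Finset.sum_const, nsmul_eq_mul]
    _ ≤ L ^ n * (Real.exp 1 * Real.exp (-c * m)) := by
        gcongr
        linarith [Real.add_one_le_exp 1]
    _ = Real.exp (n * Real.log L + 1 - c * m) := by
        rw [← Real.exp_add, ← Real.exp_log (show 0 < L by linarith), ← Real.exp_nat_mul,
          ← Real.exp_add, Real.log_exp]
        ring_nf
    _ ≤ Real.exp (-n) := by
        refine Real.exp_le_exp.2 ?_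
        have h3 : (2 + Real.log L) * n ≤ c * m := by
          rw [div_mul_eq_mul_div, div_le_iff₀ hc] at hmn
          linarith
        have h4 : (1 : ℝ) ≤ n := by exact_mod_cast hn
        nlinarith

/-! ### Gaussian moments -/

section Moments

theorem integral_abs_rpow_gaussianReal_pos {p : ℝ} (hp : 0 < p) (hp1 : p ≤ 1) :
    0 < ∫ t, |t| ^ p ∂gaussianReal 0 1 := by
  have hG := isHolderHomogeneous_abs_rpow hp hp1
  rw [integral_pos_iff_support_of_nonneg (fun t => by positivity)
    (integrable_of_abs_le_one_add_abs hG.continuous.measurable (hG.abs_le_one_add_abs hp hp1))]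
  have hsupp : (Function.support fun t : ℝ => |t| ^ p) = {0}ᶜ := by
    ext t
    simp [Real.rpow_eq_zero (abs_nonneg t) hp.ne']
  have := nullSingletonClass_gaussianReal (μ := 0) (v := 1) one_ne_zero
  rw [hsupp, prob_compl_eq_one_sub (measurableSet_singleton 0), measure_singleton]
  simp

theorem integral_mul_gaussianReal_of_sign (f : ℝ → ℝ) (u : ℤˣ) :
    ∫ t, f (((u : ℤ) : ℝ) * t) ∂gaussianReal 0 1 = ∫ t, f t ∂gaussianReal 0 1 := by
  rcases Int.units_eq_one_or u with rfl | rfl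
  · simp
  · have h : (gaussianReal 0 1).map (fun x : ℝ => -x) = gaussianReal 0 1 := by
      rw [gaussianReal_map_neg, neg_zero]
    conv_rhs => rw [← h]
    rw [show (fun x : ℝ => -x) = Homeomorph.neg ℝ from rfl,
      (Homeomorph.neg ℝ).measurableEmbedding.integral_map]
    simp

theorem isHolderHomogeneous_max_rpow {p : ℝ} (hp : 0 < p) (hp1 : p ≤ 1) (u : ℤˣ) :
    IsHolderHomogeneous p fun t => max (((u : ℤ) : ℝ) * t) 0 ^ p where
  continuous := ((continuous_const.mul continuous_id).max continuous_const).rpow_const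
    fun _ => Or.inr hp.le
  sub_le s t := by
    have h := abs_rpow_sub_abs_rpow_le hp hp1 (max (((u : ℤ) : ℝ) * s) 0)
      (max (((u : ℤ) : ℝ) * t) 0)
    rw [abs_of_nonneg (le_max_right _ _), abs_of_nonneg (le_max_right _ _)] at h
    refine h.trans (Real.rpow_le_rpow (abs_nonneg _) ?_ hp.le)
    refine (abs_max_sub_max_le_abs _ _ _).trans (le_of_eq ?_)
    rw [← mul_sub, abs_mul]
    rcases Int.units_eq_one_or u with rfl | rfl <;> simp
  map_mul c t hc := by
    rw [← Real.mul_rpow hc.le (le_max_right _ _), mul_max_of_nonneg _ _ hc.le, mul_zero,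
      mul_left_comm]

theorem isHolderHomogeneous_sign_mul (u : ℤˣ) :
    IsHolderHomogeneous 1 fun t => ((u : ℤ) : ℝ) * t where
  continuous := continuous_const.mul continuous_id
  sub_le s t := by
    rw [Real.rpow_one, ← mul_sub]
    refine (le_abs_self _).trans (le_of_eq ?_)
    rw [abs_mul]
    rcases Int.units_eq_one_or u with rfl | rfl <;> simp
  map_mul c t hc := by rw [Real.rpow_one, mul_left_comm]

/-- By symmetry of the Gaussian, the positive and the negative part of a standard Gaussian carry
half of the `p`-th absolute moment each. -/
theorem integral_max_rpow_gaussianReal {p : ℝ} (hp : 0 < p) (hp1 : p ≤ 1) (u : ℤˣ) :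
    ∫ t, max (((u : ℤ) : ℝ) * t) 0 ^ p ∂gaussianReal 0 1 =
      (∫ t, |t| ^ p ∂gaussianReal 0 1) / 2 := by
  have hint : ∀ w : ℤˣ, Integrable (fun t : ℝ => max (((w : ℤ) : ℝ) * t) 0 ^ p)
      (gaussianReal 0 1) := fun w =>
    integrable_of_abs_le_one_add_abs (isHolderHomogeneous_max_rpow hp hp1 w).continuous.measurable
      ((isHolderHomogeneous_max_rpow hp hp1 w).abs_le_one_add_abs hp hp1)
  have hval : ∀ w : ℤˣ, ∫ t, max (((w : ℤ) : ℝ) * t) 0 ^ p ∂gaussianReal 0 1 =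
      ∫ t, max t 0 ^ p ∂gaussianReal 0 1 := fun w =>
    integral_mul_gaussianReal_of_sign (fun t => max t 0 ^ p) w
  have hadd : ∫ t, |t| ^ p ∂gaussianReal 0 1 =
      ∫ t, max ((((1 : ℤˣ) : ℤ) : ℝ) * t) 0 ^ p ∂gaussianReal 0 1 +
        ∫ t, max ((((-1 : ℤˣ) : ℤ) : ℝ) * t) 0 ^ p ∂gaussianReal 0 1 := by
    rw [← integral_add (hint 1) (hint (-1))]
    refine integral_congr_ae (ae_of_all _ fun t => ?_)
    rcases le_total 0 t with h | h
    · simp [abs_of_nonneg h, h, Real.zero_rpow hp.ne']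
    · simp [abs_of_nonpos h, h, Real.zero_rpow hp.ne']
  rw [hval] at hadd ⊢
  rw [hval] at hadd
  linarith

end Moments

/-! ### The recovery criterion -/

section Deterministic

variable {m n : ℕ}

/-- For `p < 1`, the least upper bound of `|e| ^ p - |e - t| ^ p` over all errors `e` that are
admissible at the index `i`: a nonzero `e` of sign `s i` if `i ∈ T`, and `e = 0` otherwise. -/
noncomputable def signedGain (p : ℝ) (T : Finset (Fin m)) (s : Fin m → ℤˣ) (i : Fin m) (t : ℝ) :
    ℝ :=
  if i ∈ T then max (((s i : ℤ) : ℝ) * t) 0 ^ p else -|t| ^ p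

/-- The analogue of `signedGain` for `p = 1`, again a least upper bound over admissible errors; a
perturbation against the sign of the error increases the cost by its full absolute value instead of
by an arbitrarily small amount. -/
noncomputable def linearSignedGain (T : Finset (Fin m)) (s : Fin m → ℤˣ) (i : Fin m) (t : ℝ) : ℝ :=
  if i ∈ T then ((s i : ℤ) : ℝ) * t else -|t| ^ (1 : ℝ)

theorem isHolderHomogeneous_signedGain {p : ℝ} (hp : 0 < p) (hp1 : p ≤ 1) (T : Finset (Fin m))
    (s : Fin m → ℤˣ) (i : Fin m) : IsHolderHomogeneous p (signedGain p T s i) := by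
  unfold signedGain
  by_cases hi : i ∈ T
  · simp only [hi, if_true]
    exact isHolderHomogeneous_max_rpow hp hp1 (s i)
  · simp only [hi, if_false]
    exact (isHolderHomogeneous_abs_rpow hp hp1).neg

theorem isHolderHomogeneous_linearSignedGain (T : Finset (Fin m)) (s : Fin m → ℤˣ) (i : Fin m) :
    IsHolderHomogeneous 1 (linearSignedGain T s i) := by
  unfold linearSignedGain
  by_cases hi : i ∈ T
  · simp only [hi, if_true]
    exact isHolderHomogeneous_sign_mul (s i)
  · simp only [hi, if_false]
    exact (isHolderHomogeneous_abs_rpow one_pos le_rfl).neg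

theorem sum_ite_mem_const (T : Finset (Fin m)) (x y : ℝ) :
    ∑ i, (if i ∈ T then x else y) = T.card * x + (m - T.card) * y := by
  have h : ∀ i, (if i ∈ T then x else y) = (if i ∈ T then x - y else 0) + y := by
    intro i; split_ifs <;> ring
  simp_rw [h]
  rw [Finset.sum_add_distrib, Finset.sum_ite_mem]
  simp
  ring

theorem sum_integral_signedGain {p : ℝ} (hp : 0 < p) (hp1 : p ≤ 1) (T : Finset (Fin m))
    (s : Fin m → ℤˣ) :
    ∑ i, ∫ t, signedGain p T s i t ∂gaussianReal 0 1 =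
      (3 / 2 * T.card - m) * ∫ t, |t| ^ p ∂gaussianReal 0 1 := by
  have h : ∀ i, ∫ t, signedGain p T s i t ∂gaussianReal 0 1 =
      if i ∈ T then (∫ t, |t| ^ p ∂gaussianReal 0 1) / 2
        else -∫ t, |t| ^ p ∂gaussianReal 0 1 := by
    intro i
    unfold signedGain
    split_ifs
    · exact integral_max_rpow_gaussianReal hp hp1 (s i)
    · exact integral_neg _
  simp_rw [h, sum_ite_mem_const]
  ring

theorem sum_integral_linearSignedGain (T : Finset (Fin m)) (s : Fin m → ℤˣ) :
    ∑ i, ∫ t, linearSignedGain T s i t ∂gaussianReal 0 1 =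
      (T.card - m) * ∫ t, |t| ^ (1 : ℝ) ∂gaussianReal 0 1 := by
  have h : ∀ i, ∫ t, linearSignedGain T s i t ∂gaussianReal 0 1 =
      if i ∈ T then 0 else -∫ t, |t| ^ (1 : ℝ) ∂gaussianReal 0 1 := by
    intro i
    unfold linearSignedGain
    split_ifs
    · rw [integral_const_mul, integral_id_gaussianReal, mul_zero]
    · exact integral_neg _
  simp_rw [h, sum_ite_mem_const]
  ring

/-- If `ψ i` bounds the gain `|e| ^ p - |e - t| ^ p` of every admissible error at `i`, then
negativity of the total gain in all directions of the range of `A` implies recovery. -/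
theorem recoversAll_of_sum_neg {p : ℝ} {A : Matrix (Fin m) (Fin n) ℝ} {T : Finset (Fin m)}
    {s : Fin m → ℤˣ} {ψ : Fin m → ℝ → ℝ}
    (hT : ∀ i ∈ T, ∀ e t : ℝ, 0 < ((s i : ℤ) : ℝ) * e → |e| ^ p ≤ |e - t| ^ p + ψ i t)
    (hTc : ∀ i ∉ T, ∀ t : ℝ, |0| ^ p ≤ |0 - t| ^ p + ψ i t)
    (hA : ∀ z : Fin n → ℝ, z ≠ 0 → ∑ i, ψ i (A.mulVec z i) < 0) : RecoversAll p A T s := by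
  intro f e he x hx
  have hz := hA (x - f) (sub_ne_zero.2 hx)
  have e1 : A.mulVec f + e - A.mulVec f = e := add_sub_cancel_left _ _
  have e2 : A.mulVec f + e - A.mulVec x = e - A.mulVec (x - f) := by
    rw [Matrix.mulVec_sub]; abel
  rw [e1, e2]
  unfold lpCost
  have hle : ∑ i, |e i| ^ p ≤
      ∑ i, (|(e - A.mulVec (x - f)) i| ^ p + ψ i (A.mulVec (x - f) i)) := by
    refine Finset.sum_le_sum fun i _ => ?_
    by_cases hi : i ∈ T
    · exact hT i hi _ _ (he.2 i hi)
    · have h0 : e i = 0 := by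
        by_contra h
        exact hi ((he.1 i).1 h)
      rw [Pi.sub_apply, h0]
      exact hTc i hi _
  rw [Finset.sum_add_distrib] at hle
  linarith

theorem sign_sq (u : ℤˣ) : ((u : ℤ) : ℝ) * ((u : ℤ) : ℝ) = 1 := by
  rcases Int.units_eq_one_or u with rfl | rfl <;> simp

theorem abs_sign (u : ℤˣ) : |((u : ℤ) : ℝ)| = 1 := by
  rcases Int.units_eq_one_or u with rfl | rfl <;> simp

theorem recoversAll_of_sum_signedGain_neg {p : ℝ} (hp : 0 < p) (hp1 : p ≤ 1)
    {A : Matrix (Fin m) (Fin n) ℝ} {T : Finset (Fin m)} {s : Fin m → ℤˣ}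
    (hA : ∀ z : Fin n → ℝ, z ≠ 0 → ∑ i, signedGain p T s i (A.mulVec z i) < 0) :
    RecoversAll p A T s := by
  refine recoversAll_of_sum_neg (fun i hi e t he => ?_) (fun i hi t => ?_) hA
  · simp only [signedGain, hi, if_true]
    set σ := ((s i : ℤ) : ℝ)
    have habs : ∀ r : ℝ, |r| = |σ * r| := fun r => by rw [abs_mul, abs_sign, one_mul]
    rcases le_total (σ * t) 0 with h | h
    · rw [max_eq_right h, Real.zero_rpow hp.ne', add_zero]
      refine Real.rpow_le_rpow (abs_nonneg _) ?_ hp.le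
      rw [habs e, habs (e - t), abs_of_pos he, mul_sub, abs_of_pos (by linarith)]
      linarith
    · have h1 := abs_rpow_sub_abs_rpow_le hp hp1 e (e - t)
      rw [sub_sub_cancel, habs t, abs_of_nonneg h] at h1
      rw [max_eq_left h]
      linarith
  · simp [signedGain, hi, Real.zero_rpow hp.ne']

theorem recoversAll_one_of_sum_linearSignedGain_neg
    {A : Matrix (Fin m) (Fin n) ℝ} {T : Finset (Fin m)} {s : Fin m → ℤˣ}
    (hA : ∀ z : Fin n → ℝ, z ≠ 0 → ∑ i, linearSignedGain T s i (A.mulVec z i) < 0) :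
    RecoversAll 1 A T s := by
  refine recoversAll_of_sum_neg (fun i hi e t he => ?_) (fun i hi t => ?_) hA
  · simp only [linearSignedGain, hi, if_true, Real.rpow_one]
    have habs : ∀ r : ℝ, |r| = |((s i : ℤ) : ℝ) * r| := fun r => by
      rw [abs_mul, abs_sign, one_mul]
    rw [habs e, habs (e - t), abs_of_pos he, mul_sub]
    linarith [le_abs_self (((s i : ℤ) : ℝ) * e - ((s i : ℤ) : ℝ) * t)]
  · simp [linearSignedGain, hi]

theorem tendsto_add_rpow_sub_rpow_atTop {p : ℝ} (hp : 0 < p) (hp1 : p < 1) {a : ℝ} (ha : 0 ≤ a) :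
    Filter.Tendsto (fun R : ℝ => (R + a) ^ p - R ^ p) Filter.atTop (nhds 0) := by
  have hlim : Filter.Tendsto (fun R : ℝ => p * a * R ^ (-(1 - p))) Filter.atTop (nhds 0) := by
    simpa using (tendsto_rpow_neg_atTop (sub_pos.2 hp1)).const_mul (p * a)
  refine tendsto_of_tendsto_of_tendsto_of_le_of_le' tendsto_const_nhds hlim ?_ ?_
  · filter_upwards [Filter.eventually_gt_atTop 0] with R hR
    exact sub_nonneg.2 (Real.rpow_le_rpow hR.le (by linarith) hp.le)
  · filter_upwards [Filter.eventually_gt_atTop 0] with R hR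
    have h1 : (R + a) ^ p = R ^ p * (1 + a / R) ^ p := by
      rw [← Real.mul_rpow hR.le (by positivity)]
      congr 1
      field_simp
    have h2 := rpow_one_add_le_one_add_mul_self (s := a / R)
      (by linarith [div_nonneg ha hR.le]) hp.le hp1.le
    have h3 : R ^ (-(1 - p)) = R ^ p / R := by
      rw [neg_sub, Real.rpow_sub hR, Real.rpow_one]
    rw [h1, h3]
    have h4 := mul_le_mul_of_nonneg_left h2 (Real.rpow_nonneg hR.le p)
    calc R ^ p * (1 + a / R) ^ p - R ^ p ≤ R ^ p * (1 + p * (a / R)) - R ^ p := by linarith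
      _ = p * a * (R ^ p / R) := by ring

/-- For `p < 1` the criterion of `recoversAll_of_sum_signedGain_neg` is necessary, up to the
boundary case: where `A z` agrees in sign with the error, the error is taken equal to `A z`; where
it disagrees, the error is taken so large that the cost of the disagreement becomes negligible. -/
theorem sum_signedGain_nonpos_of_recoversAll {p : ℝ} (hp : 0 < p) (hp1 : p < 1)
    {A : Matrix (Fin m) (Fin n) ℝ} {T : Finset (Fin m)} {s : Fin m → ℤˣ}
    (h : RecoversAll p A T s) {z : Fin n → ℝ} (hz : z ≠ 0) :
    ∑ i, signedGain p T s i (A.mulVec z i) ≤ 0 := by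
  set v := A.mulVec z
  set e : ℝ → Fin m → ℝ := fun R i =>
    if i ∈ T then (if 0 < ((s i : ℤ) : ℝ) * v i then v i else ((s i : ℤ) : ℝ) * R) else 0
  have hpos : ∀ R : ℝ, 0 < R → ∀ i ∈ T, 0 < ((s i : ℤ) : ℝ) * e R i := by
    intro R hR i hi
    simp only [e, hi, if_true]
    split_ifs with hv
    · exact hv
    · rw [← mul_assoc, sign_sq, one_mul]; exact hR
  have hcost : ∀ R : ℝ, 0 < R → 0 ≤ ∑ i, (|e R i - v i| ^ p - |e R i| ^ p) := by
    intro R hR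
    have he : HasSupportAndSigns (e R) T s := by
      refine ⟨fun i => ⟨fun h0 => ?_, fun hi h0 => ?_⟩, hpos R hR⟩
      · by_contra hi
        exact h0 (by simp [e, hi])
      · have := hpos R hR i hi
        rw [h0, mul_zero] at this
        exact lt_irrefl _ this
    have hlt := h 0 (e R) he z hz
    simp only [Matrix.mulVec_zero, zero_add, lpCost, Pi.sub_apply, Pi.zero_apply, sub_zero] at hlt
    rw [Finset.sum_sub_distrib]
    exact (sub_pos.2 hlt).le
  have hlim : Filter.Tendsto (fun R : ℝ => ∑ i, (|e R i - v i| ^ p - |e R i| ^ p)) Filter.atTop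
      (nhds (∑ i, -signedGain p T s i (v i))) := by
    refine tendsto_finsetSum _ fun i _ => ?_
    by_cases hi : i ∈ T
    · simp only [e, signedGain, hi, if_true]
      set σ := ((s i : ℤ) : ℝ)
      have habs : ∀ r : ℝ, |r| = |σ * r| := fun r => by rw [abs_mul, abs_sign, one_mul]
      by_cases hv : 0 < σ * v i
      · simp only [hv, if_true, sub_self, abs_zero, Real.zero_rpow hp.ne', zero_sub]
        rw [max_eq_left hv.le, habs (v i), abs_of_pos hv]
        exact tendsto_const_nhds
      · simp only [hv, if_false]
        rw [not_lt] at hv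
        rw [max_eq_right hv, Real.zero_rpow hp.ne', neg_zero]
        refine (tendsto_add_rpow_sub_rpow_atTop hp hp1 (neg_nonneg.2 hv)).congr' ?_
        filter_upwards [Filter.eventually_gt_atTop 0] with R hR
        rw [habs (σ * R - v i), habs (σ * R), mul_sub, ← mul_assoc, sign_sq, one_mul,
          abs_of_pos hR, abs_of_pos (by linarith), sub_eq_add_neg R]
    · simp [e, signedGain, hi, Real.zero_rpow hp.ne']
  have hge := ge_of_tendsto hlim ((Filter.eventually_gt_atTop 0).mono hcost)
  rw [Finset.sum_neg_distrib] at hge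
  linarith

end Deterministic

/-! ### Recovery and failure with high probability -/

theorem exists_measure_not_recoversAll_le {p ρ : ℝ} (hp : 0 < p) (hp1 : p < 1) (hρ : ρ < 2 / 3) :
    ∃ C : ℝ, 0 < C ∧ ∀ n : ℕ, 1 ≤ n → ∀ m : ℕ, C * n ≤ m →
      ∀ (T : Finset (Fin m)) (s : Fin m → ℤˣ), (T.card : ℝ) ≤ ρ * m →
        (gaussianMatrixLaw m n).real {a | ¬ RecoversAll p (Matrix.of a) T s} ≤ Real.exp (-n) := by
  have hμ := integral_abs_rpow_gaussianReal_pos hp hp1.le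
  have hd : 0 < (1 - 3 / 2 * ρ) * ∫ t, |t| ^ p ∂gaussianReal 0 1 := mul_pos (by linarith) hμ
  obtain ⟨C, hC, h⟩ := exists_measure_exists_sum_mulVec_nonneg_le hp hp1.le hd
  refine ⟨C, hC, fun n hn m hm T s hT => ?_⟩
  refine (measureReal_mono ?_ (measure_ne_top _ _)).trans (h n hn m hm (signedGain p T s)
    (isHolderHomogeneous_signedGain hp hp1.le T s) ?_)
  · intro a ha
    by_contra hcon
    refine ha (recoversAll_of_sum_signedGain_neg hp hp1.le fun z hz => ?_)
    by_contra hneg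
    exact hcon ⟨z, hz, not_lt.1 hneg⟩
  · rw [sum_integral_signedGain hp hp1.le]
    nlinarith

theorem exists_measure_recoversAll_le {p ρ : ℝ} (hp : 0 < p) (hp1 : p < 1) (hρ : 2 / 3 < ρ) :
    ∃ c : ℝ, 0 < c ∧ ∀ m n : ℕ, 1 ≤ n →
      ∀ (T : Finset (Fin m)) (s : Fin m → ℤˣ), ρ * m ≤ (T.card : ℝ) →
        (gaussianMatrixLaw m n).real {a | RecoversAll p (Matrix.of a) T s} ≤
          Real.exp (-c * m) := by
  have hμ := integral_abs_rpow_gaussianReal_pos hp hp1.le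
  have hd : 0 < (3 / 2 * ρ - 1) * ∫ t, |t| ^ p ∂gaussianReal 0 1 := mul_pos (by linarith) hμ
  obtain ⟨c, hc, h⟩ := exists_measure_sum_mulVec_ge_le hd
  refine ⟨c, hc, fun m n hn T s hT => ?_⟩
  -- A single direction suffices: the first basis vector, whose image is the first column of `A`.
  set z : Fin n → ℝ := Pi.single ⟨0, hn⟩ 1
  have hz : z ≠ 0 := by simp [z]
  have hz1 : ∑ j, z j ^ 2 = 1 := by simp [z, Pi.single_apply, ite_pow]
  have hH := isHolderHomogeneous_signedGain hp hp1.le T s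
  refine (measureReal_mono ?_ (measure_ne_top _ _)).trans (h m (fun i t => -signedGain p T s i t) 0
    (fun i => (hH i).neg.continuous.measurable) (fun i => (hH i).neg.abs_le_one_add_abs hp hp1.le)
    ?_ n z hz1)
  · intro a ha
    have := sum_signedGain_nonpos_of_recoversAll hp hp1 ha hz
    simp only [Set.mem_ofPred_eq, Finset.sum_neg_distrib, zero_mul]
    linarith
  · simp_rw [integral_neg]
    rw [Finset.sum_neg_distrib, sum_integral_signedGain hp hp1.le]
    nlinarith

theorem exists_measure_not_recoversAll_one_le {ρ : ℝ} (hρ : ρ < 1) :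
    ∃ C : ℝ, 0 < C ∧ ∀ n : ℕ, 1 ≤ n → ∀ m : ℕ, C * n ≤ m →
      ∀ (T : Finset (Fin m)) (s : Fin m → ℤˣ), (T.card : ℝ) ≤ ρ * m →
        (gaussianMatrixLaw m n).real {a | ¬ RecoversAll 1 (Matrix.of a) T s} ≤ Real.exp (-n) := by
  have hμ := integral_abs_rpow_gaussianReal_pos one_pos le_rfl
  have hd : 0 < (1 - ρ) * ∫ t, |t| ^ (1 : ℝ) ∂gaussianReal 0 1 := mul_pos (by linarith) hμ
  obtain ⟨C, hC, h⟩ := exists_measure_exists_sum_mulVec_nonneg_le one_pos le_rfl hd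
  refine ⟨C, hC, fun n hn m hm T s hT => ?_⟩
  refine (measureReal_mono ?_ (measure_ne_top _ _)).trans (h n hn m hm (linearSignedGain T s)
    (isHolderHomogeneous_linearSignedGain T s) ?_)
  · intro a ha
    by_contra hcon
    refine ha (recoversAll_one_of_sum_linearSignedGain_neg fun z hz => ?_)
    by_contra hneg
    exact hcon ⟨z, hz, not_lt.1 hneg⟩
  · rw [sum_integral_linearSignedGain]
    nlinarith

-- "An event has probability at least `1 - ε`" is written as "its complement has measure at
-- most `ε`".
-- The three conjuncts are: recovery below the threshold `2/3` for `0 < p < 1`; failure above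
-- `2/3` for `0 < p < 1`; recovery below the threshold `1` for `p = 1`.
theorem mainTheorem4 :
    (∀ p : ℝ, 0 < p → p < 1 → ∀ ρ : ℝ, ρ < 2 / 3 →
      ∃ c₇ : ℝ, 0 < c₇ ∧ ∃ c₈ : ℝ, 0 < c₈ ∧ ∃ N : ℕ, ∀ n : ℕ, N ≤ n →
        ∀ m : ℕ, c₇ * (n : ℝ) ≤ (m : ℝ) →
          ∀ (T : Finset (Fin m)) (s : Fin m → ℤˣ), (T.card : ℝ) ≤ ρ * (m : ℝ) →
            (gaussianMatrixLaw m n).real {a | ¬ RecoversAll p (Matrix.of a) T s}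
              ≤ Real.exp (-c₈ * (n : ℝ))) ∧
    (∀ p : ℝ, 0 < p → p < 1 → ∀ ρ : ℝ, 2 / 3 < ρ →
      ∃ c : ℝ, 0 < c ∧ ∃ M : ℕ, ∀ m : ℕ, M ≤ m → ∀ n : ℕ, 1 ≤ n →
        ∀ (T : Finset (Fin m)) (s : Fin m → ℤˣ), ρ * (m : ℝ) ≤ (T.card : ℝ) →
          (gaussianMatrixLaw m n).real {a | RecoversAll p (Matrix.of a) T s}
            ≤ Real.exp (-c * (m : ℝ))) ∧
    (∀ ρ : ℝ, ρ < 1 →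
      ∃ c₇ : ℝ, 0 < c₇ ∧ ∃ c₈ : ℝ, 0 < c₈ ∧ ∃ N : ℕ, ∀ n : ℕ, N ≤ n →
        ∀ m : ℕ, c₇ * (n : ℝ) ≤ (m : ℝ) →
          ∀ (T : Finset (Fin m)) (s : Fin m → ℤˣ), (T.card : ℝ) ≤ ρ * (m : ℝ) →
            (gaussianMatrixLaw m n).real {a | ¬ RecoversAll 1 (Matrix.of a) T s}
              ≤ Real.exp (-c₈ * (n : ℝ))) := by
  refine ⟨fun p hp hp1 ρ hρ => ?_, fun p hp hp1 ρ hρ => ?_, fun ρ hρ => ?_⟩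
  · obtain ⟨C, hC, h⟩ := exists_measure_not_recoversAll_le hp hp1 hρ
    refine ⟨C, hC, 1, one_pos, 1, fun n hn m hm T s hT => ?_⟩
    rw [neg_one_mul]
    exact h n hn m hm T s hT
  · obtain ⟨c, hc, h⟩ := exists_measure_recoversAll_le hp hp1 hρ
    exact ⟨c, hc, 0, fun m _ n hn T s hT => h m n hn T s hT⟩
  · obtain ⟨C, hC, h⟩ := exists_measure_not_recoversAll_one_le hρ
    refine ⟨C, hC, 1, one_pos, 1, fun n hn m hm T s hT => ?_⟩
    rw [neg_one_mul]
    exact h n hn m hm T s hT
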